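/- Let $U_1,\dots,U_K$ be pairwise disjoint finite sets with $|U_k| = c_k$, let $C=\max_k c_k$ and $V=\bigcup_k U_k$. Let $\mathcal G=(V,E,w)$ be the graph in which two vertices are joined by an edge iff they lie in different sets $U_k$, with non-negative edge weights $w$. An orthogonal partition is a partition $\Phi=(V_1,\dots,V_C)$ of $V$ into $C$ cliques of $\mathcal G$, that is, every $V_j$ contains at most one vertex of each $U_k$. Its weight $w(\Phi)$ is the total weight of the edges that have both endpoints in the same $V_j$. An orthogonal partition $\Phi$ is $(1-\epsilon)$-approximate if $w(\Phi)\ge(1-\epsilon)\max_{\Psi}w(\Psi)$, the maximum being over all orthogonal partitions $\Psi$. Randomized local search with parameters $M,N$ runs $N$ independent epochs and returns a partition of largest weight among those obtained at the ends of the epochs. An epoch starts from a uniformly random orthogonal partition and performs $M$ iterations. In an iteration, an edge $uv$ with endpoints in different cliques $V_a\ni u$ and $V_b\ni v$ of the current partition is sampled with probability proportional to its weight. Then, independently, with probability $\tfrac12$ the vertex $u$ is swapped with the vertex $u'\in V_b$ of the same set $U_k$ as $u$, and with probability $\tfrac12$ the vertex $v$ is swapped with the vertex $v'\in V_a$ of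 the same set $U_\kappa$ as $v$. Here $a,b,u',v'$ refer to the partition before the iteration; if $u'$ (or $v'$) does not exist, then $u$ just moves to $V_b$ (or $v$ to $V_a$). If the edges between different cliques have total weight $0$, the iteration leaves the partition unchanged. Theorem. For $M=\mathcal O(CK)$ and $N$ large enough, randomized local search returns a $(1-\epsilon)$-approximate maximum orthogonal partition with probability at least $1-\frac1e$. Precisely: for every constant $a\in\mathbb N$ there is a function $N_0=N_0(C,K)$ such that for every such graph, all $M\le a\,CK$, all $N\ge N_0(C,K)$ and every $\epsilon>0$, the output of randomized local search with parameters $M,N$ is a $(1-\epsilon)$-approximate maximum orthogonal partition with probability at least $1-\frac1e$. -/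

import Mathlib

open scoped NNReal ENNReal

noncomputable section

namespace LabelMapping

/-- The vertex set `V`: the pair `⟨k, i⟩` is the `i`-th speaker of the hypothesis `k`. -/
abbrev Speaker {K : ℕ} (c : Fin K → ℕ) : Type := Σ k : Fin K, Fin (c k)

/-- `C = max c_k`, the largest number of speakers in a hypothesis. -/
def maxSpeakers {K : ℕ} (c : Fin K → ℕ) : ℕ := Finset.univ.sup c

/-- The `K`-partite graph on the speakers: two speakers are adjacent iff they belong to
different hypotheses. -/
abbrev speakerGraph {K : ℕ} (c : Fin K → ℕ) : SimpleGraph (Speaker c) :=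
  SimpleGraph.completeMultipartiteGraph fun k => Fin (c k)

/-- An orthogonal partition `(V_1, …, V_C)` of the speakers into `C` disjoint cliques, given by
the function that sends each speaker to the index of its clique. Being a clique means here that
each part holds at most one speaker of every hypothesis. -/
def OrthPartition {K : ℕ} (c : Fin K → ℕ) : Type :=
  {σ : Speaker c → Fin (maxSpeakers c) // ∀ j, (speakerGraph c).IsClique {v | σ v = j}}

variable {K : ℕ} {c : Fin K → ℕ}

instance : Fintype (OrthPartition c) := by
  classical
  unfold OrthPartition
  infer_instance

instance : Nonempty (OrthPartition c) := by
  have hle : ∀ k, c k ≤ maxSpeakers c := fun k => Finset.le_sup (f := c) (Finset.mem_univ k)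
  refine ⟨⟨fun v => Fin.castLE (hle v.1) v.2, ?_⟩⟩
  rintro j ⟨k, i⟩ hu ⟨l, i'⟩ hv hne
  change k ≠ l
  rintro rfl
  apply hne
  have h : Fin.castLE (hle k) i = Fin.castLE (hle k) i' := hu.trans hv.symm
  rw [Fin.castLE_injective (hle k) h]

/-- The edge set `E`; every unordered edge is listed exactly once, as the pair `(u, v)` in which
the hypothesis of `u` comes before the hypothesis of `v`. -/
def edges (c : Fin K → ℕ) : Finset (Speaker c × Speaker c) :=
  Finset.univ.filter fun e => e.1.1 < e.2.1

/-- `E(V_j)`: the edges of the subgraph induced by the `j`-th part. -/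
def cliqueEdges (Φ : OrthPartition c) (j : Fin (maxSpeakers c)) :
    Finset (Speaker c × Speaker c) :=
  (edges c).filter fun e => Φ.1 e.1 = j ∧ Φ.1 e.2 = j

/-- The edges between different cliques of `Φ`. -/
def crossEdges (Φ : OrthPartition c) : Finset (Speaker c × Speaker c) :=
  (edges c).filter fun e => Φ.1 e.1 ≠ Φ.1 e.2

/-- The objective `J(Φ) = w(Φ)`: the total weight of the edges within the cliques. Only the values
of `w` on `edges c` matter. -/
def weight (w : Speaker c × Speaker c → ℝ≥0) (Φ : OrthPartition c) : ℝ≥0 :=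
  ∑ j, ∑ e ∈ cliqueEdges Φ j, w e

/-- The total weight of the edges between different cliques of `Φ`. -/
def crossWeight (w : Speaker c × Speaker c → ℝ≥0) (Φ : OrthPartition c) : ℝ≥0 :=
  ∑ e ∈ crossEdges Φ, w e

/-- The weight of a maximum orthogonal partition. -/
def optWeight (w : Speaker c × Speaker c → ℝ≥0) : ℝ≥0 :=
  Finset.univ.sup fun Φ : OrthPartition c => weight w Φ

/-- `Φ` is a `(1 - ε)`-approximate maximum orthogonal partition. -/
def IsApprox (w : Speaker c × Speaker c → ℝ≥0) (ε : ℝ) (Φ : OrthPartition c) : Prop :=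
  (1 - ε) * (optWeight w : ℝ) ≤ (weight w Φ : ℝ)

/-- Swap the speaker `u` with the speaker `u'` of the same hypothesis that lies in the clique `b`:
within the hypothesis of `u`, the cliques `Φ.1 u` and `b` exchange their members. If there is no
such `u'`, then `u` moves to the clique `b`. -/
def swapInto (Φ : OrthPartition c) (u : Speaker c) (b : Fin (maxSpeakers c)) :
    OrthPartition c :=
  ⟨fun x => if x.1 = u.1 then Equiv.swap (Φ.1 u) b (Φ.1 x) else Φ.1 x, by
    intro j x hx y hy hne
    have hxy : (if x.1 = u.1 then Equiv.swap (Φ.1 u) b (Φ.1 x) else Φ.1 x) =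
        (if y.1 = u.1 then Equiv.swap (Φ.1 u) b (Φ.1 y) else Φ.1 y) := hx.trans hy.symm
    change x.1 ≠ y.1
    intro h
    have hlab : Φ.1 x = Φ.1 y := by
      rw [h] at hxy
      split_ifs at hxy with hu
      · exact (Equiv.swap _ _).injective hxy
      · exact hxy
    exact Φ.2 (Φ.1 y) hlab rfl hne h⟩

/-- Sample a cross-clique edge with probability proportional to its weight. -/
def sampleEdge (w : Speaker c × Speaker c → ℝ≥0) (Φ : OrthPartition c)
    (h : crossWeight w Φ ≠ 0) : PMF (Speaker c × Speaker c) :=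
  PMF.ofFinset
    (fun e => if e ∈ crossEdges Φ then ((w e / crossWeight w Φ : ℝ≥0) : ℝ≥0∞) else 0)
    (crossEdges Φ)
    (by
      rw [Finset.sum_congr rfl fun e he => if_pos he, ← ENNReal.ofNNReal_finsetSum,
        ← Finset.sum_div]
      change ((crossWeight w Φ / crossWeight w Φ : ℝ≥0) : ℝ≥0∞) = 1
      rw [div_self h, ENNReal.coe_one])
    (fun _ he => if_neg he)

/-- One iteration of the local search. A cross-clique edge `(u, v)` is sampled; then, by two
independent fair coins, `u` is swapped with the speaker `u'` of its hypothesis that lay in the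
clique of `v`, and `v` is swapped with the speaker `v'` of its hypothesis that lay in the clique
of `u`. If no cross-clique edge has positive weight, there is nothing to sample and `Φ` is kept. -/
def step (w : Speaker c × Speaker c → ℝ≥0) (Φ : OrthPartition c) : PMF (OrthPartition c) :=
  if h : crossWeight w Φ = 0 then PMF.pure Φ
  else
    (sampleEdge w Φ h).bind fun e =>
      (PMF.uniformOfFintype Bool).bind fun s =>
        (PMF.uniformOfFintype Bool).bind fun t =>
          let Φ₁ := if s then swapInto Φ e.1 (Φ.1 e.2) else Φ
          PMF.pure (if t then swapInto Φ₁ e.2 (Φ.1 e.1) else Φ₁)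

/-- One epoch: a uniformly random orthogonal partition, followed by `M` iterations. -/
def epoch (w : Speaker c × Speaker c → ℝ≥0) : ℕ → PMF (OrthPartition c)
  | 0 => PMF.uniformOfFintype (OrthPartition c)
  | M + 1 => (epoch w M).bind (step w)

/-- The incumbent is replaced if there is none yet or if the weight increases. -/
def better (w : Speaker c × Speaker c → ℝ≥0) :
    Option (OrthPartition c) → OrthPartition c → OrthPartition c
  | none, Ψ => Ψ
  | some Φ, Ψ => if weight w Φ < weight w Ψ then Ψ else Φ

/-- The law of the output of the randomized local search with `N` independent epochs of `M`
iterations each (`none`, the initial incumbent, is returned only if `N = 0`). -/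
def randomizedLocalSearch (w : Speaker c × Speaker c → ℝ≥0) (M : ℕ) :
    ℕ → PMF (Option (OrthPartition c))
  | 0 => PMF.pure none
  | N + 1 =>
    (randomizedLocalSearch w M N).bind fun best =>
      (epoch w M).bind fun Ψ => PMF.pure (some (better w best Ψ))

end LabelMapping

end

/-!
Why the theorem holds: an iteration leaves the current partition unchanged whenever both coins come
up tails, so whatever the weights are it keeps a given partition with probability at least `1/4`
(`quarter_le_step_self`). An epoch starts at a maximum partition with probability at least
`1 / |OrthPartition c|`, and hence still is at this partition after `M` iterations with probability
at least `4⁻ᴹ / |OrthPartition c|` (`le_epoch_apply`). As there are at most `C ^ (C K)` orthogonal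
partitions, for `M ≤ a C K` this is at least `p = 1 / (4 ^ (a C K) * C ^ (C K))`, independently of
the weights and of the sizes `c k` beyond their maximum `C`.

The incumbent is optimal as soon as one epoch ends in an optimal partition, so by independence of
the epochs the search fails with probability at most `(1 - p) ^ N ≤ exp (-p N)`
(`randomizedLocalSearch_compl_isMax_le`), which is at most `1 / e` once `N ≥ 1 / p`.
A maximum partition is `(1 - ε)`-approximate for every `ε > 0`, so the bound on `N` does not involve
`ε`.
-/

open scoped NNReal ENNReal

theorem PMF.toOuterMeasure_add_compl {α : Type*} (p : PMF α) (s : Set α) :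
    p.toOuterMeasure s + p.toOuterMeasure sᶜ = 1 := by
  rw [PMF.toOuterMeasure_apply, PMF.toOuterMeasure_apply, ← ENNReal.tsum_add, ← p.tsum_coe]
  exact tsum_congr fun x => Set.indicator_self_add_compl_apply s p x

theorem PMF.toOuterMeasure_compl_le {α : Type*} (p : PMF α) {s : Set α} {q : ℝ≥0∞}
    (h : q ≤ p.toOuterMeasure s) : p.toOuterMeasure sᶜ ≤ 1 - q := by
  have hs := p.toOuterMeasure_add_compl s
  have hq : q ≠ ⊤ := ne_top_of_le_ne_top ENNReal.one_ne_top
    (h.trans (hs ▸ le_self_add))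
  refine ENNReal.le_sub_of_add_le_left hq ?_
  rw [← hs]
  gcongr

theorem PMF.mul_le_bind_apply {α β : Type*} (p : PMF α) (f : α → PMF β) (x : α) (y : β) :
    p x * f x y ≤ p.bind f y := by
  rw [PMF.bind_apply]
  exact ENNReal.le_tsum x

theorem PMF.le_bind_apply {α β : Type*} (p : PMF α) (f : α → PMF β) (y : β) {q : ℝ≥0∞}
    (h : ∀ x, q ≤ f x y) : q ≤ p.bind f y := by
  rw [PMF.bind_apply]
  calc q = ∑' x, p x * q := by rw [ENNReal.tsum_mul_right, p.tsum_coe, one_mul]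
    _ ≤ ∑' x, p x * f x y := ENNReal.tsum_le_tsum fun x => by gcongr; exact h x

namespace LabelMapping

variable {K : ℕ} {c : Fin K → ℕ}

/-- The lazy part of the dynamics: both coins come up tails with probability `1/4`. -/
theorem quarter_le_step_self (w : Speaker c × Speaker c → ℝ≥0) (Φ : OrthPartition c) :
    4⁻¹ ≤ step w Φ Φ := by
  unfold step
  split_ifs with h
  · simp
  · refine PMF.le_bind_apply _ _ _ fun e => ?_
    have half : PMF.uniformOfFintype Bool false = 2⁻¹ := by simp
    calc (4⁻¹ : ℝ≥0∞) = 2⁻¹ * (2⁻¹ * 1) := by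
          rw [mul_one, ← ENNReal.mul_inv (by simp) (by simp)]; norm_num
      _ ≤ _ := by
          refine le_trans ?_ (PMF.mul_le_bind_apply _ _ false Φ)
          rw [half]
          gcongr
          refine le_trans ?_ (PMF.mul_le_bind_apply _ _ false Φ)
          rw [half]
          simp

theorem le_epoch_apply (w : Speaker c × Speaker c → ℝ≥0) (Φ : OrthPartition c) (M : ℕ) :
    (Fintype.card (OrthPartition c) : ℝ≥0∞)⁻¹ * 4⁻¹ ^ M ≤ epoch w M Φ := by
  induction M with
  | zero => simp [epoch]
  | succ M ih =>
    calc _ = (Fintype.card (OrthPartition c) : ℝ≥0∞)⁻¹ * 4⁻¹ ^ M * 4⁻¹ := by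
          rw [pow_succ, mul_assoc]
      _ ≤ epoch w M Φ * step w Φ Φ := by gcongr; exact quarter_le_step_self w Φ
      _ ≤ _ := PMF.mul_le_bind_apply _ _ _ _

theorem card_speaker_le (c : Fin K → ℕ) : Fintype.card (Speaker c) ≤ maxSpeakers c * K := by
  rw [Fintype.card_sigma]
  calc ∑ k, Fintype.card (Fin (c k)) ≤ ∑ _k : Fin K, maxSpeakers c :=
        Finset.sum_le_sum fun k _ => by
          rw [Fintype.card_fin]; exact Finset.le_sup (f := c) (Finset.mem_univ k)
    _ = maxSpeakers c * K := by simp [mul_comm]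

theorem card_orthPartition_le (c : Fin K → ℕ) :
    Fintype.card (OrthPartition c) ≤ maxSpeakers c ^ (maxSpeakers c * K) := by
  classical
  have h := card_speaker_le c
  calc Fintype.card (OrthPartition c) ≤ Fintype.card (Speaker c → Fin (maxSpeakers c)) :=
        Fintype.card_le_of_injective (fun Φ : OrthPartition c => Φ.1) Subtype.val_injective
    _ = maxSpeakers c ^ Fintype.card (Speaker c) := by simp
    _ ≤ maxSpeakers c ^ (maxSpeakers c * K) := by
        rcases Nat.eq_zero_or_pos (maxSpeakers c) with h0 | h0
        -- Without speakers both exponents vanish, and the bound reads `0 ^ 0 ≤ 0 ^ 0`.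
        · rw [h0, zero_mul] at h ⊢
          rw [Nat.le_zero.mp h]
        · exact Nat.pow_le_pow_right h0 h

theorem weight_le_optWeight (w : Speaker c × Speaker c → ℝ≥0) (Φ : OrthPartition c) :
    weight w Φ ≤ optWeight w :=
  Finset.le_sup (f := fun Φ : OrthPartition c => weight w Φ) (Finset.mem_univ Φ)

theorem exists_weight_eq_optWeight (w : Speaker c × Speaker c → ℝ≥0) :
    ∃ Φ : OrthPartition c, weight w Φ = optWeight w := by
  obtain ⟨Φ, -, h⟩ := Finset.exists_mem_eq_sup Finset.univ Finset.univ_nonempty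
    fun Φ : OrthPartition c => weight w Φ
  exact ⟨Φ, h.symm⟩

theorem isApprox_of_weight_eq (w : Speaker c × Speaker c → ℝ≥0) {ε : ℝ} (hε : 0 ≤ ε)
    {Φ : OrthPartition c} (h : weight w Φ = optWeight w) : IsApprox w ε Φ := by
  unfold IsApprox
  rw [h]
  nlinarith [mul_nonneg hε (optWeight w).coe_nonneg]

theorem weight_le_weight_better (w : Speaker c × Speaker c → ℝ≥0)
    (best : Option (OrthPartition c)) (Ψ : OrthPartition c) :
    weight w Ψ ≤ weight w (better w best Ψ) := by
  cases best with
  | none => exact le_rfl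
  | some Φ =>
    rw [better]
    split_ifs with h
    · exact le_rfl
    · exact not_lt.mp h

theorem weight_le_weight_better_some (w : Speaker c × Speaker c → ℝ≥0)
    (Φ Ψ : OrthPartition c) : weight w Φ ≤ weight w (better w (some Φ) Ψ) := by
  rw [better]
  split_ifs with h
  · exact h.le
  · exact le_rfl

/-- If one epoch ends in a maximum partition with probability at least `q`, then `N` epochs all miss
the maximum with probability at most `(1 - q) ^ N`. -/
theorem randomizedLocalSearch_compl_isMax_le (w : Speaker c × Speaker c → ℝ≥0) (M : ℕ) {q : ℝ≥0∞}
    (hq : q ≤ (epoch w M).toOuterMeasure {Φ | weight w Φ = optWeight w}) (N : ℕ) :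
    (randomizedLocalSearch w M N).toOuterMeasure
      {out | ∃ Φ, out = some Φ ∧ weight w Φ = optWeight w}ᶜ ≤ (1 - q) ^ N := by
  induction N with
  | zero =>
    calc _ ≤ (1 : ℝ≥0∞) := by
          rw [← PMF.toOuterMeasure_add_compl (randomizedLocalSearch w M 0)
            {out | ∃ Φ, out = some Φ ∧ weight w Φ = optWeight w}]
          exact le_add_self
      _ = _ := (pow_zero _).symm
  | succ N ih =>
    set A : Set (Option (OrthPartition c)) :=
      {out | ∃ Φ, out = some Φ ∧ weight w Φ = optWeight w}
    have mem_of_le : ∀ Φ, optWeight w ≤ weight w Φ → some Φ ∈ A := fun Φ h =>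
      ⟨Φ, rfl, le_antisymm (weight_le_optWeight w Φ) h⟩
    have pure_compl : ∀ x ∈ A, (PMF.pure x).toOuterMeasure Aᶜ = 0 := fun x hx => by
      rw [PMF.toOuterMeasure_pure_apply, if_neg (fun h : x ∈ Aᶜ => h hx)]
    have key : ∀ best, ((epoch w M).bind fun Ψ =>
        PMF.pure (some (better w best Ψ))).toOuterMeasure Aᶜ ≤
          Set.indicator Aᶜ (fun _ => 1 - q) best := by
      intro best
      rw [PMF.toOuterMeasure_bind_apply]
      by_cases hb : best ∈ A
      -- An optimal incumbent is never lost.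
      · obtain ⟨Φ, rfl, hΦ⟩ := hb
        have h0 : ∀ Ψ, (PMF.pure (some (better w (some Φ) Ψ))).toOuterMeasure Aᶜ = 0 := fun Ψ =>
          pure_compl _ (mem_of_le _ (hΦ ▸ weight_le_weight_better_some w Φ Ψ))
        simp only [h0, mul_zero, tsum_zero, zero_le]
      -- Otherwise the epoch itself has to miss the maximum.
      · rw [Set.indicator_of_mem (show best ∈ Aᶜ from hb)]
        refine le_trans ?_ (PMF.toOuterMeasure_compl_le _ hq)
        rw [PMF.toOuterMeasure_apply]
        refine ENNReal.tsum_le_tsum fun Ψ => ?_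
        by_cases hΨ : weight w Ψ = optWeight w
        · rw [pure_compl _ (mem_of_le _ (hΨ ▸ weight_le_weight_better w best Ψ)), mul_zero]
          exact zero_le
        · rw [Set.indicator_of_mem (show Ψ ∈ {Φ | weight w Φ = optWeight w}ᶜ from hΨ),
            PMF.toOuterMeasure_pure_apply]
          split_ifs <;> simp
    calc (randomizedLocalSearch w M (N + 1)).toOuterMeasure Aᶜ
        = ∑' best, randomizedLocalSearch w M N best * ((epoch w M).bind fun Ψ =>
            PMF.pure (some (better w best Ψ))).toOuterMeasure Aᶜ := by
          rw [randomizedLocalSearch, PMF.toOuterMeasure_bind_apply]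
      _ ≤ ∑' best, Set.indicator Aᶜ (randomizedLocalSearch w M N) best * (1 - q) := by
          refine ENNReal.tsum_le_tsum fun best => ?_
          refine (mul_le_mul_right (key best) _).trans ?_
          by_cases hb : best ∈ Aᶜ <;> simp [hb]
      _ = (randomizedLocalSearch w M N).toOuterMeasure Aᶜ * (1 - q) := by
          rw [ENNReal.tsum_mul_right, PMF.toOuterMeasure_apply]
      _ ≤ (1 - q) ^ (N + 1) := by
          rw [pow_succ]
          gcongr

end LabelMapping

theorem one_sub_inv_pow_le_exp_neg_one {n N : ℕ} (hn : 0 < n) (h : n ≤ N) :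
    (1 - (n : ℝ)⁻¹) ^ N ≤ Real.exp (-1) := by
  have hn' : (0 : ℝ) < n := by exact_mod_cast hn
  have h1 : (n : ℝ)⁻¹ ≤ 1 := inv_le_one_of_one_le₀ (by exact_mod_cast hn)
  calc (1 - (n : ℝ)⁻¹) ^ N ≤ Real.exp (-(n : ℝ)⁻¹) ^ N :=
        pow_le_pow_left₀ (by linarith) (Real.one_sub_le_exp_neg _) _
    _ = Real.exp (N * -(n : ℝ)⁻¹) := (Real.exp_nat_mul _ _).symm
    _ ≤ Real.exp (-1) := by
        apply Real.exp_le_exp.mpr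
        have h2 : (1 : ℝ) ≤ N * (n : ℝ)⁻¹ := by
          rw [← div_eq_mul_inv, one_le_div hn']
          exact_mod_cast h
        linarith

theorem theorem2 (a : ℕ) :
    ∃ N₀ : ℕ → ℕ → ℕ,
      ∀ (K : ℕ) (c : Fin K → ℕ)
        (w : LabelMapping.Speaker c × LabelMapping.Speaker c → NNReal) (M N : ℕ) (ε : ℝ),
        M ≤ a * (LabelMapping.maxSpeakers c * K) →
        N₀ (LabelMapping.maxSpeakers c) K ≤ N →
        0 < ε →
        ENNReal.ofReal (1 - 1 / Real.exp 1) ≤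
          (LabelMapping.randomizedLocalSearch w M N).toOuterMeasure
            {out | ∃ Φ, out = some Φ ∧ LabelMapping.IsApprox w ε Φ} := by
  refine ⟨fun C K => C ^ (C * K) * 4 ^ (a * (C * K)), ?_⟩
  intro K c w M N ε hM hN hε
  set C := LabelMapping.maxSpeakers c
  set n : ℕ := C ^ (C * K) * 4 ^ (a * (C * K))
  have hcard := LabelMapping.card_orthPartition_le c
  have hn : 0 < n := Nat.mul_pos (Fintype.card_pos.trans_le hcard) (by positivity)
  obtain ⟨Φ, hΦ⟩ := LabelMapping.exists_weight_eq_optWeight w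
  have hq : (n : ℝ≥0∞)⁻¹ ≤ (LabelMapping.epoch w M).toOuterMeasure
      {Φ | LabelMapping.weight w Φ = LabelMapping.optWeight w} := by
    calc (n : ℝ≥0∞)⁻¹
        ≤ ((Fintype.card (LabelMapping.OrthPartition c) * 4 ^ M : ℕ) : ℝ≥0∞)⁻¹ := by
          refine ENNReal.inv_le_inv.mpr (Nat.cast_le.mpr ?_)
          exact Nat.mul_le_mul hcard (Nat.pow_le_pow_right (by norm_num) hM)
      _ = (Fintype.card (LabelMapping.OrthPartition c) : ℝ≥0∞)⁻¹ * 4⁻¹ ^ M := by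
          push_cast
          rw [ENNReal.mul_inv (by simp) (by simp), ENNReal.inv_pow]
      _ ≤ LabelMapping.epoch w M Φ := LabelMapping.le_epoch_apply w Φ M
      _ = (LabelMapping.epoch w M).toOuterMeasure {Φ} :=
          (PMF.toOuterMeasure_apply_singleton _ _).symm
      _ ≤ _ := MeasureTheory.measure_mono (Set.singleton_subset_iff.mpr hΦ)
  have hfail := LabelMapping.randomizedLocalSearch_compl_isMax_le w M hq N
  have hexp : (1 - (n : ℝ≥0∞)⁻¹) ^ N ≤ ENNReal.ofReal (1 / Real.exp 1) := by
    have h1 : (n : ℝ)⁻¹ ≤ 1 := inv_le_one_of_one_le₀ (by exact_mod_cast hn)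
    have h2 : (1 - (n : ℝ≥0∞)⁻¹) = ENNReal.ofReal (1 - (n : ℝ)⁻¹) := by
      rw [ENNReal.ofReal_sub _ (by positivity), ENNReal.ofReal_one,
        ENNReal.ofReal_inv_of_pos (by exact_mod_cast hn), ENNReal.ofReal_natCast]
    rw [h2, ← ENNReal.ofReal_pow (by linarith), one_div, ← Real.exp_neg]
    exact ENNReal.ofReal_le_ofReal (one_sub_inv_pow_le_exp_neg_one hn hN)
  calc ENNReal.ofReal (1 - 1 / Real.exp 1) = 1 - ENNReal.ofReal (1 / Real.exp 1) := by
        rw [ENNReal.ofReal_sub _ (by positivity), ENNReal.ofReal_one]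
    _ ≤ (LabelMapping.randomizedLocalSearch w M N).toOuterMeasure
          {out | ∃ Φ, out = some Φ ∧ LabelMapping.weight w Φ = LabelMapping.optWeight w} := by
        rw [tsub_le_iff_right, ← PMF.toOuterMeasure_add_compl
          (LabelMapping.randomizedLocalSearch w M N)
          {out | ∃ Φ, out = some Φ ∧ LabelMapping.weight w Φ = LabelMapping.optWeight w}]
        gcongr
        exact hfail.trans hexp
    _ ≤ _ := by
        refine MeasureTheory.measure_mono ?_
        rintro out ⟨Ψ, rfl, hΨ⟩
        exact ⟨Ψ, rfl, LabelMapping.isApprox_of_weight_eq w hε.le hΨ⟩
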